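/- All graphs are finite and simple. A graph is distance hereditary if the distance between any two vertices is the same in every connected induced subgraph containing them. A graph-labelled tree is a finite tree $T$ in which every node (non-leaf vertex) $v$ is labelled by a graph $G_v$ whose vertices are in bijection $\rho_v$ with the tree-edges incident to $v$; the vertex of a one-vertex tree counts as a leaf. It is a clique-star tree if every label is a complete graph or a star $K_{1,n}$. For a leaf $l$, a leaf $l'\ne l$ is $l$-accessible if $\rho_v(e)\rho_v(e')\in E(G_v)$ for any two distinct tree-edges $e,e'$ of the $l,l'$-path of $T$ that share a vertex $v$. The accessibility set of $l$ is the set of all pairs $\{l,l'\}$ with $l'$ an $l$-accessible leaf. The intersection graph of an indexed family of sets has the indices as vertices, two distinct indices being adjacent if and only if their sets intersect. Theorem (Intersection model). A graph is distance hereditary if and only if it is (isomorphic to) the intersection graph of a family of accessibility sets of leaves in a set of pairwise disjoint clique-star trees. Moreover, for a distance hereditary graph, the trees can be chosen such that the family consists of the accessibility sets of all the leaves of the trees, each leaf being taken exactly once. -/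

import Mathlib

universe u

/-- A graph is distance hereditary if the distance between two vertices is the same in every
connected induced subgraph that contains them (in particular, as in the graph itself). -/
def SimpleGraph.IsDistanceHereditary {V : Type u} (G : SimpleGraph V) : Prop :=
  ∀ S : Set V, (G.induce S).Connected →
    ∀ x y : S, (G.induce S).dist x y = G.dist (x : V) (y : V)

/-- The intersection graph of an indexed family of sets: distinct indices are adjacent
if and only if their sets intersect. -/
def intersectionGraph {J β : Type*} (A : J → Set β) : SimpleGraph J where
  Adj i j := i ≠ j ∧ (A i ∩ A j).Nonempty
  symm := ⟨fun _ _ h => ⟨h.1.symm, by rw [Set.inter_comm]; exact h.2⟩⟩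
  loopless := ⟨fun _ h => h.1 rfl⟩

/-- A star: the complete bipartite graph `K_{1,n}`, given by its centre `c`. -/
def SimpleGraph.IsStar {M : Type u} (H : SimpleGraph M) : Prop :=
  ∃ c : M, ∀ a b : M, H.Adj a b ↔ a ≠ b ∧ (a = c ∨ b = c)

/-- A (finite) graph-labelled tree. The marker vertices of the label of `v` are in bijection with
the tree-edges incident to `v`, that is, with the neighbours of `v`; we take the neighbours
themselves as marker vertices, so that the edge `vw` has the marker vertex `w` in the label of `v`.
The label of a vertex with at most one neighbour carries no information. -/
structure GraphLabelledTree where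
  /-- leaves and nodes of the tree -/
  Vert : Type u
  finite_vert : Finite Vert
  tree : SimpleGraph Vert
  isTree : tree.IsTree
  label : (v : Vert) → SimpleGraph (tree.neighborSet v)

namespace GraphLabelledTree

/-- A leaf is a vertex of degree at most one (degree zero occurs for the one-vertex tree only). -/
def IsLeaf (T : GraphLabelledTree.{u}) (v : T.Vert) : Prop :=
  (T.tree.neighborSet v).Subsingleton

/-- `u` is `l`-accessible: `u` differs from `l`, and any two distinct tree-edges `vw`, `vw'` on
the path of the tree from `l` to `u` have adjacent marker vertices in the label of `v`. -/
def IsAccessible (T : GraphLabelledTree.{u}) (l u : T.Vert) : Prop :=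
  u ≠ l ∧ ∀ p : T.tree.Walk l u, p.IsPath →
    ∀ (v w w' : T.Vert) (hw : T.tree.Adj v w) (hw' : T.tree.Adj v w'), w ≠ w' →
      s(v, w) ∈ p.edges → s(v, w') ∈ p.edges → (T.label v).Adj ⟨w, hw⟩ ⟨w', hw'⟩

/-- A clique-star tree: the label of every node (internal vertex) is a clique or a star. -/
def IsCliqueStar (T : GraphLabelledTree.{u}) : Prop :=
  ∀ v : T.Vert, ¬ T.IsLeaf v → T.label v = ⊤ ∨ (T.label v).IsStar

/-- The leaves of the (disjoint) trees of a family. -/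
abbrev Leaves {ι : Type u} (𝒯 : ι → GraphLabelledTree.{u}) : Type u :=
  {x : Σ i, (𝒯 i).Vert // (𝒯 x.1).IsLeaf x.2}

/-- The accessibility set of a leaf `l` of one of the trees of a family: the set of unordered pairs
`{l, l'}` where `l'` is an `l`-accessible leaf (of the same tree). -/
def accessibilitySet {ι : Type u} (𝒯 : ι → GraphLabelledTree.{u}) (l : Leaves 𝒯) :
    Set (Sym2 (Σ i, (𝒯 i).Vert)) :=
  {e | ∃ l' : (𝒯 l.1.1).Vert, (𝒯 l.1.1).IsLeaf l' ∧ (𝒯 l.1.1).IsAccessible l.1.2 l' ∧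
    e = s(l.1, ⟨l.1.1, l'⟩)}

end GraphLabelledTree

/-!
The proof replaces distance heredity by a local property (`WalksMeetCommonNeighbors`): if `x` and
`r` are at distance two, then every walk from `x` to `r` passes through a common neighbour of
them. Taking the support of the walk as vertex set shows that it follows from distance heredity.
Conversely, it extends from distance two to all distances by induction
(`exists_closer_neighbor`), which gives distance heredity. The property is visibly inherited by
induced subgraphs.

From trees to graphs: in a tree, accessibility of `l` and `u` means that at every vertex `v` where
`l` and `u` lie in different branches, the markers of these branches are adjacent
(`isAccessible_iff`). If `x` and `r` are not adjacent but have a common neighbour `z`, then at some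
node `m` the branches of `x` and `r` are not adjacent, although both are adjacent to that of `z`.
So `m` is labelled by a star with centre towards `z`, and the first step of a walk from `x` to `r`
out of the branch of `x` leads into the branch of `z`, to a vertex that is adjacent to both `x` and
`r` (`exists_separating_node`).

From graphs to trees: a connected graph with the property and at least three vertices has a pendant
vertex or a pair of twins (`exists_pendant_or_twin`). Indeed, deleting a vertex and its neighbours
leaves components that are sides of splits (`splitIn_component`); a smallest split side therefore
has two elements, and these are twins, or one is pendant at the other. Removing a pendant vertex or
a twin `x` of `v` leaves a connected graph, hence by induction a clique-star tree whose leaves are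
the remaining vertices. Turning the leaf of `v` into a node of degree three with new leaves for `v`
and `x`, labelled by a triangle or a star, gives the tree for the whole graph (`extend`). For a
disconnected graph, one takes a tree for each component.
-/

/-! ### Distance heredity and common neighbours on walks -/

namespace SimpleGraph

variable {V : Type u} {G : SimpleGraph V}

/-- Every walk between two vertices at distance two passes through a common neighbour of them.
This is distance heredity restricted to distance two; it is equivalent to distance heredity
(`isDistanceHereditary_iff`) and, unlike it, mentions neither distances nor connectedness. -/
def WalksMeetCommonNeighbors (G : SimpleGraph V) : Prop :=
  ∀ ⦃x r z : V⦄, x ≠ r → ¬ G.Adj x r → G.Adj x z → G.Adj z r →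
    ∀ w : G.Walk x r, ∃ c ∈ w.support, G.Adj x c ∧ G.Adj c r

theorem WalksMeetCommonNeighbors.comap {W : Type*} {H : SimpleGraph W} (f : H ↪g G)
    (hG : G.WalksMeetCommonNeighbors) : H.WalksMeetCommonNeighbors := by
  intro x r z hne hnadj hxz hzr w
  obtain ⟨c, hc, h1, h2⟩ := hG (f.injective.ne hne) (fun h => hnadj (f.map_adj_iff.1 h))
    (f.map_adj_iff.2 hxz) (f.map_adj_iff.2 hzr) (w.map f.toHom)
  rw [Walk.support_map, List.mem_map] at hc
  obtain ⟨d, hd, rfl⟩ := hc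
  exact ⟨d, hd, f.map_adj_iff.1 h1, f.map_adj_iff.1 h2⟩

theorem WalksMeetCommonNeighbors.induce (hG : G.WalksMeetCommonNeighbors) (S : Set V) :
    (G.induce S).WalksMeetCommonNeighbors :=
  hG.comap (Embedding.induce S)

theorem Walk.exists_common_neighbor {x r : V} (q : G.Walk x r) (hne : x ≠ r)
    (hnadj : ¬ G.Adj x r) (hq : q.length ≤ 2) : ∃ c, G.Adj x c ∧ G.Adj c r := by
  match q, hq with
  | .nil, _ => exact absurd rfl hne
  | .cons h .nil, _ => exact absurd h hnadj
  | .cons h (.cons h' .nil), _ => exact ⟨_, h, h'⟩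
  | .cons _ (.cons _ (.cons _ _)), hd => simp at hd

theorem IsDistanceHereditary.walksMeetCommonNeighbors (hG : G.IsDistanceHereditary) :
    G.WalksMeetCommonNeighbors := by
  intro x r z hne hnadj hxz hzr w
  have hS := w.connected_induce_support
  let x' : {v | v ∈ w.support} := ⟨x, w.start_mem_support⟩
  let r' : {v | v ∈ w.support} := ⟨r, w.end_mem_support⟩
  have hd : (G.induce {v | v ∈ w.support}).dist x' r' ≤ 2 := by
    rw [hG _ hS x' r']
    exact dist_le (Walk.cons hxz (Walk.cons hzr Walk.nil))
  obtain ⟨q, hq⟩ := hS.exists_walk_length_eq_dist x' r'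
  rw [← hq] at hd
  obtain ⟨c, h1, h2⟩ := q.exists_common_neighbor (fun h => hne (congrArg Subtype.val h)) hnadj hd
  exact ⟨c, c.2, h1, h2⟩

/-- A walk that leaves `S` has an initial segment inside `S` followed by a step out of `S`. -/
theorem Walk.exists_first_exit {S : Set V} {x r : V} (w : G.Walk x r) (hx : x ∈ S) (hr : r ∉ S) :
    ∃ (y z : V) (p : G.Walk x y), (∀ s ∈ p.support, s ∈ S) ∧ G.Adj y z ∧ z ∉ S ∧
      z ∈ w.support := by
  induction w with
  | nil => exact absurd hx hr
  | @cons a b c h q ih =>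
    by_cases hb : b ∈ S
    · obtain ⟨y, z, p, hp, hyz, hz, hzw⟩ := ih hb hr
      refine ⟨y, z, .cons h p, ?_, hyz, hz, by simp [hzw]⟩
      intro s hs
      rw [Walk.support_cons, List.mem_cons] at hs
      rcases hs with rfl | hs
      exacts [hx, hp s hs]
    · exact ⟨a, b, .nil, by simpa using hx, h, hb, by simp⟩

theorem exists_adj_dist_eq {x r : V} {i : ℕ} (h : G.dist x r = i + 1) :
    ∃ z, G.Adj x z ∧ G.dist z r = i := by
  obtain ⟨p, hp⟩ := exists_walk_of_dist_ne_zero (G := G) (u := x) (v := r) (by omega)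
  match p, hp with
  | .nil, hp => simp at h
  | .cons (v := z) hxz q, hp =>
    refine ⟨z, hxz, ?_⟩
    have h1 := dist_le q
    have h2 := hxz.diff_dist_adj (u := r)
    rw [Walk.length_cons] at hp
    rw [G.dist_comm (u := r), G.dist_comm (u := r)] at h2
    omega

theorem Walk.dist_lt_of_mem_support {t r : V} (p : G.Walk t r) (hp : p.length = G.dist t r)
    {s : V} (hs : s ∈ p.support) (hst : s ≠ t) : G.dist s r < G.dist t r := by
  classical
  match p with
  | .nil => simp at hs; exact absurd hs hst
  | .cons h q =>
    rw [Walk.support_cons, List.mem_cons] at hs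
    have hs := hs.resolve_left hst
    have h1 := dist_le (q.dropUntil s hs)
    have h2 := q.length_dropUntil_le_length hs
    rw [Walk.length_cons] at hp
    omega

/-- The extension of the defining property from distance two to all distances: a walk from `x` to
`r` contains a neighbour of `x` that is closer to `r`. The first vertex of the walk that is closer
to `r` will do: by induction it has a common neighbour `t`, even closer to `r`, with the second
vertex of a geodesic from `x` to `r`, so that `x` and `t` have distance two. -/
theorem WalksMeetCommonNeighbors.exists_closer_neighbor (hG : G.WalksMeetCommonNeighbors)
    {i : ℕ} {x r : V} (h : G.dist x r = i + 1) (w : G.Walk x r) :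
    ∃ c ∈ w.support, G.Adj x c ∧ G.dist c r = i := by
  induction i generalizing x r with
  | zero => exact ⟨r, w.end_mem_support, dist_eq_one_iff_adj.1 h, dist_self⟩
  | succ i ih =>
    have step : ∀ {a b : V}, G.Adj a b → G.dist a r ≤ G.dist b r + 1 := by
      intro a b hab
      have h2 := hab.diff_dist_adj (u := r)
      rw [G.dist_comm (u := r), G.dist_comm (u := r)] at h2
      omega
    obtain ⟨y, z', p, hp, hyz, hz', hzw⟩ := w.exists_first_exit
      (S := {v | i + 2 ≤ G.dist v r}) (by simp [h]) (by simp)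
    have hy := hp y p.end_mem_support
    simp only [Set.mem_ofPred_eq, not_le] at hp hy hz'
    have hz'' : G.dist z' r = i + 1 := by have := step hyz; omega
    obtain ⟨z, hxz, hz⟩ := exists_adj_dist_eq h
    obtain ⟨t, hzt, ht⟩ := exists_adj_dist_eq hz''
    have htr : G.Reachable t r := ⟨.cons hzt.symm (.cons hyz.symm (p.reverse.append w))⟩
    obtain ⟨g, hg⟩ := htr.exists_walk_length_eq_dist
    obtain ⟨c, hc, hzc, hcr⟩ := ih hz
      (.cons hxz.symm (p.append (.cons hyz (.cons hzt g))))
    have hct : c = t := by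
      by_contra hct
      simp only [Walk.support_cons, List.mem_cons, Walk.mem_support_append_iff] at hc
      rcases hc with rfl | hc | rfl | rfl | hc
      · exact hzc.ne rfl
      · have := hp c hc; omega
      · have := hp _ p.end_mem_support; omega
      · omega
      · have := g.dist_lt_of_mem_support hg hc hct; omega
    subst hct
    have hne : x ≠ c := by rintro rfl; omega
    obtain ⟨d, hd, hxd, hdc⟩ := hG hne (fun hxc => by have := step hxc; omega) hxz hzc
      (p.append (.cons hyz (.cons hzt .nil)))
    simp only [Walk.support_cons, List.mem_cons, Walk.mem_support_append_iff, Walk.support_nil,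
      List.not_mem_nil, or_false] at hd
    have hdr := step hdc
    have hdz : d = z' := by
      rcases hd with hd | rfl | rfl | rfl
      · have := hp d hd; omega
      · omega
      · rfl
      · exact absurd rfl hdc.ne
    exact ⟨z', hzw, hdz ▸ hxd, hz''⟩

theorem WalksMeetCommonNeighbors.isDistanceHereditary (hG : G.WalksMeetCommonNeighbors) :
    G.IsDistanceHereditary := by
  intro S hS x y
  apply le_antisymm
  · have main : ∀ (i : ℕ) (x : S), G.dist (x : V) (y : V) = i → (G.induce S).dist x y ≤ i := by
      intro i
      induction i with
      | zero =>
        intro x hx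
        have hxy : G.Reachable (x : V) (y : V) :=
          (hS x y).map (Embedding.induce S).toHom
        rw [hxy.dist_eq_zero_iff] at hx
        rw [Subtype.ext hx, dist_self]
      | succ i ih =>
        intro x hx
        obtain ⟨w⟩ := hS x y
        obtain ⟨c, hc, hxc, hcy⟩ := hG.exists_closer_neighbor hx
          (w.map (Embedding.induce S).toHom)
        obtain ⟨c, -, rfl⟩ := List.mem_map.1
          ((congrArg (c ∈ ·) (Walk.support_map (Embedding.induce S).toHom w)).mp hc)
        have h1 := ih c hcy
        have h2 : (G.induce S).dist x c = 1 := dist_eq_one_iff_adj.2 hxc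
        have := hS.dist_triangle (u := x) (v := c) (w := y)
        omega
    exact main _ x rfl
  · obtain ⟨p, hp⟩ := hS.exists_walk_length_eq_dist x y
    rw [← hp, ← Walk.length_map (Embedding.induce S).toHom]
    exact dist_le _

theorem isDistanceHereditary_iff : G.IsDistanceHereditary ↔ G.WalksMeetCommonNeighbors :=
  ⟨fun h => h.walksMeetCommonNeighbors, fun h => h.isDistanceHereditary⟩

end SimpleGraph

/-! ### Pendant vertices and twins -/

namespace SimpleGraph

variable {V : Type u} {G : SimpleGraph V}

/-- In the subgraph induced by `H`, the edges between `A` and its complement form a complete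
bipartite graph (possibly with isolated vertices), that is, `A` and `H \ A` form a split if both
have at least two vertices. -/
def SplitIn (G : SimpleGraph V) (H A : Set V) : Prop :=
  ∀ ⦃x⦄, x ∈ A → ∀ ⦃y⦄, y ∈ A → ∀ ⦃z⦄, z ∈ H → z ∉ A → ∀ ⦃z'⦄, z' ∈ H → z' ∉ A →
    G.Adj x z → G.Adj y z' → G.Adj x z'

theorem SplitIn.diff {H A : Set V} (h : G.SplitIn H A) : G.SplitIn H (H \ A) := by
  intro x hx y hy z hz hzA z' hz' hzA' hxz hyz'
  have mem : ∀ {a}, a ∈ H → a ∉ H \ A → a ∈ A := fun h1 h2 => by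
    by_contra h3
    exact h2 ⟨h1, h3⟩
  exact (h (mem hz' hzA') (mem hz hzA) hy.1 hy.2 hx.1 hx.2 hyz'.symm hxz.symm).symm

/-- A component of the graph that remains when `r` and its neighbours are deleted from `H` is one
side of a split. -/
theorem WalksMeetCommonNeighbors.splitIn_component (hG : G.WalksMeetCommonNeighbors)
    (H : Set V) (r p : V) :
    G.SplitIn H {q | ∃ w : G.Walk p q, ∀ s ∈ w.support, s ∈ H ∧ s ≠ r ∧ ¬ G.Adj r s} := by
  have boundary : ∀ {x z : V} (w : G.Walk p x),
      (∀ s ∈ w.support, s ∈ H ∧ s ≠ r ∧ ¬ G.Adj r s) → z ∈ H → G.Adj x z →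
      (¬ ∃ w : G.Walk p z, ∀ s ∈ w.support, s ∈ H ∧ s ≠ r ∧ ¬ G.Adj r s) → G.Adj z r := by
    intro x z w hw hz hxz hn
    by_contra hzr
    refine hn ⟨w.concat hxz, fun s hs => ?_⟩
    rw [Walk.support_concat, List.mem_append, List.mem_singleton] at hs
    rcases hs with hs | rfl
    · exact hw s hs
    · refine ⟨hz, ?_, fun h => hzr h.symm⟩
      rintro rfl
      exact (hw x w.end_mem_support).2.2 hxz.symm
  rintro x ⟨w, hw⟩ y ⟨w', hw'⟩ z hz hzC z' hz' hzC' hxz hyz'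
  have hx := (hw x w.end_mem_support).2
  obtain ⟨c, hc, hxc, hcr⟩ := hG hx.1 (fun h => hx.2 h.symm) hxz (boundary w hw hz hxz hzC)
    (w.reverse.append (w'.append (.cons hyz' (.cons (boundary w' hw' hz' hyz' hzC') .nil))))
  simp only [Walk.support_cons, List.mem_cons, Walk.mem_support_append_iff, Walk.support_nil,
    List.not_mem_nil, or_false, Walk.support_reverse, List.mem_reverse] at hc
  rcases hc with hc | hc | rfl | rfl | rfl
  · exact absurd hcr.symm (hw c hc).2.2
  · exact absurd hcr.symm (hw' c hc).2.2
  · exact absurd hcr.symm (hw' c w'.end_mem_support).2.2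
  · exact hxc
  · exact absurd rfl hcr.ne

/-- If `b` represents the outside of a split side `A`, then the splits of `G` restricted to
`insert b A` extend to splits of `G`. -/
theorem SplitIn.of_insert {A B : Set V} {a b : V} (hA : G.SplitIn Set.univ A) (ha : a ∈ A)
    (hb : b ∉ A) (hab : G.Adj a b) (hBA : B ⊆ A) (hB : G.SplitIn (insert b A) B) :
    G.SplitIn Set.univ B := by
  have toB : ∀ {x z : V}, x ∈ A → z ∉ A → G.Adj x z → G.Adj x b := fun hx hz hxz =>
    hA hx ha trivial hz trivial hb hxz hab
  -- the neighbours outside `A` are replaced by `b`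
  have key : ∀ {x z : V}, x ∈ B → z ∉ B → G.Adj x z →
      ∃ f ∈ insert b A, f ∉ B ∧ G.Adj x f ∧ (z ∈ A → f = z) ∧ (z ∉ A → f = b) := by
    intro x z hx hz hxz
    by_cases hzA : z ∈ A
    · exact ⟨z, Or.inr hzA, hz, hxz, fun _ => rfl, fun h => absurd hzA h⟩
    · exact ⟨b, Or.inl rfl, fun h => hb (hBA h), toB (hBA hx) hzA hxz, fun h => absurd h hzA,
        fun _ => rfl⟩
  intro x hx y hy z _ hz z' _ hz' hxz hyz'
  obtain ⟨f, hf, hfB, hxf, -, -⟩ := key hx hz hxz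
  obtain ⟨f', hf', hfB', hyf', h1, h2⟩ := key hy hz' hyz'
  have hxf' := hB hx hy hf hfB hf' hfB' hxf hyf'
  by_cases hzA' : z' ∈ A
  · rwa [← h1 hzA']
  · rw [h2 hzA'] at hxf'
    exact hA (hBA hx) (hBA hy) trivial hb trivial hzA' hxf' hyz'

theorem splitIn_pair {H : Set V} {x y : V}
    (h : ∀ z ∈ H, z ≠ x → z ≠ y → (G.Adj x z ↔ G.Adj y z)) : G.SplitIn H {x, y} := by
  intro a ha b hb z hz hzA z' hz' hzA' haz hbz'
  simp only [Set.mem_insert_iff, Set.mem_singleton_iff, not_or] at ha hb hzA hzA'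
  have := h z' hz' hzA'.1 hzA'.2
  rcases ha with rfl | rfl <;> rcases hb with rfl | rfl <;> tauto

/-- A smallest side of a split has exactly two elements. If it had more, consider it together with
one outer vertex `b`. By minimality and `splitIn_component`, the non-neighbours of every vertex
are independent there, that is, this graph is complete multipartite, and so it has twins different
from `b`, which form a smaller split side. -/
theorem WalksMeetCommonNeighbors.exists_splitIn_pair [Finite V] (hG : G.WalksMeetCommonNeighbors)
    (hc : G.Connected) (hV : 3 ≤ Nat.card V) : ∃ x y, x ≠ y ∧ G.SplitIn Set.univ {x, y} := by
  let P : Set V → Prop := fun A => A.Nontrivial ∧ A ≠ Set.univ ∧ G.SplitIn Set.univ A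
  have hex : ∃ A, P A := by
    obtain ⟨v⟩ := hc.nonempty
    refine ⟨{v}ᶜ, ?_, by simp, ?_⟩
    · rw [← Set.one_lt_ncard_iff_nontrivial]
      have := Set.ncard_add_ncard_compl {v}
      rw [Set.ncard_singleton] at this
      omega
    · intro x hx y hy z _ hz z' _ hz' hxz _
      simp only [Set.mem_compl_iff, Set.mem_singleton_iff, not_not] at hz hz'
      rwa [hz', ← hz]
  obtain ⟨A, hA⟩ := (Set.toFinite {A | P A}).exists_minimal hex
  obtain ⟨⟨hA2, hAu, hAs⟩, hmin⟩ : P A ∧ ∀ B, P B → B ⊆ A → A ⊆ B :=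
    ⟨hA.prop, fun B hB hBA => hA.le_of_le hB hBA⟩
  obtain ⟨a, b, ha, hb, hab⟩ : ∃ a b, a ∈ A ∧ b ∉ A ∧ G.Adj a b := by
    obtain ⟨a, ha⟩ := hA2.nonempty
    obtain ⟨b, hb⟩ := (Set.ne_univ_iff_exists_notMem A).1 hAu
    obtain ⟨w⟩ := hc a b
    obtain ⟨y, z, p, hp, hyz, hz, -⟩ := w.exists_first_exit ha hb
    exact ⟨y, z, hp y p.end_mem_support, hz, hyz⟩
  have toB : ∀ {x z : V}, x ∈ A → z ∉ A → G.Adj x z → G.Adj x b := fun hx hz hxz =>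
    hAs hx ha trivial hz trivial hb hxz hab
  have small : ∀ B : Set V, B ⊆ A → B.Nontrivial → G.SplitIn (insert b A) B → A ⊆ B :=
    fun B hBA hB2 hB => hmin B ⟨hB2, fun h => hAu (Set.univ_subset_iff.1 (h ▸ hBA)),
      hAs.of_insert ha hb hab hBA hB⟩ hBA
  have multipartite : ∀ r ∈ insert b A, ∀ p ∈ insert b A, ∀ q ∈ insert b A, G.Adj p q →
      r ≠ p → r ≠ q → ¬ G.Adj r p → G.Adj r q := by
    intro r hr p hp q hq hpq hrp hrq hnp
    by_contra hnq
    obtain ⟨t, ht, hrt⟩ : ∃ t ∈ insert b A, G.Adj r t := by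
      rcases hr with rfl | hr
      · exact ⟨a, Or.inr ha, hab.symm⟩
      · obtain ⟨v, hv⟩ := hA2.exists_ne r
        obtain ⟨t, hrt⟩ : ∃ t, G.Adj r t := by
          obtain ⟨w⟩ := hc r v
          cases w with
          | nil => exact absurd rfl hv.2
          | cons h _ => exact ⟨_, h⟩
        by_cases htA : t ∈ A
        · exact ⟨t, Or.inr htA, hrt⟩
        · exact ⟨b, Or.inl rfl, toB hr htA hrt⟩
    have hC := hG.splitIn_component (insert b A) r p
    set C := {q | ∃ w : G.Walk p q, ∀ s ∈ w.support, s ∈ insert b A ∧ s ≠ r ∧ ¬ G.Adj r s}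
    have hCH : ∀ {s}, s ∈ C → s ∈ insert b A ∧ s ≠ r ∧ ¬ G.Adj r s := by
      rintro s ⟨w, hw⟩
      exact hw s w.end_mem_support
    have hpC : p ∈ C := ⟨.nil, by simp; simpa using ⟨hp, hrp.symm, hnp⟩⟩
    have hqC : q ∈ C := ⟨.cons hpq .nil, by
      intro s hs
      simp only [Walk.support_cons, Walk.support_nil, List.mem_cons, List.not_mem_nil,
        or_false] at hs
      rcases hs with rfl | rfl
      exacts [⟨hp, hrp.symm, hnp⟩, ⟨hq, hrq.symm, hnq⟩]⟩
    have hrC : r ∉ C := fun h => (hCH h).2.1 rfl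
    have htC : t ∉ C := fun h => (hCH h).2.2 hrt
    by_cases hbC : b ∈ C
    · have hsub := small (insert b A \ C)
        (fun s hs => hs.1.resolve_left (by rintro rfl; exact hs.2 hbC))
        ⟨r, ⟨hr, hrC⟩, t, ⟨ht, htC⟩, hrt.ne⟩ hC.diff
      have only : ∀ {s}, s ∈ C → s = b := fun hs =>
        (hCH hs).1.resolve_right fun h => (hsub h).2 hs
      exact hpq.ne ((only hpC).trans (only hqC).symm)
    · have hsub := small C (fun s hs => (hCH hs).1.resolve_left (by rintro rfl; exact hbC hs))
        ⟨p, hpC, q, hqC, hpq.ne⟩ hC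
      have only : ∀ {s}, s ∈ insert b A → s ∉ C → s = b := fun h hs =>
        h.resolve_right fun h => hs (hsub h)
      exact hrt.ne ((only hr hrC).trans (only ht htC).symm)
  obtain ⟨x, hx, y, hy, hxy, hs⟩ : ∃ x ∈ A, ∃ y ∈ A, x ≠ y ∧ A ⊆ {x, y} := by
    obtain ⟨x, hx, y, hy, hxy⟩ := hA2
    by_cases h3 : A ⊆ {x, y}
    · exact ⟨x, hx, y, hy, hxy, h3⟩
    suffices ∃ x ∈ A, ∃ y ∈ A, x ≠ y ∧ G.SplitIn (insert b A) {x, y} by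
      obtain ⟨x, hx, y, hy, hxy, hs⟩ := this
      exact ⟨x, hx, y, hy, hxy, small _ (Set.insert_subset hx (Set.singleton_subset_iff.2 hy))
        (Set.nontrivial_pair hxy) hs⟩
    by_cases hcl : ∀ u ∈ A, ∀ v ∈ A, u ≠ v → G.Adj u v
    · -- in a clique, two elements that agree on adjacency to `b` are twins
      have twins : ∀ u ∈ A, ∀ v ∈ A, (G.Adj u b ↔ G.Adj v b) →
          G.SplitIn (insert b A) {u, v} := by
        intro u hu v hv huv
        apply splitIn_pair
        rintro z (rfl | hz) hzu hzv
        · exact huv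
        · exact iff_of_true (hcl u hu z hz hzu.symm) (hcl v hv z hz hzv.symm)
      obtain ⟨z, hz, hzn⟩ := Set.not_subset.1 h3
      simp only [Set.mem_insert_iff, Set.mem_singleton_iff, not_or] at hzn
      by_cases h1 : G.Adj x b ↔ G.Adj y b
      · exact ⟨x, hx, y, hy, hxy, twins x hx y hy h1⟩
      by_cases h2 : G.Adj z b ↔ G.Adj x b
      · exact ⟨z, hz, x, hx, hzn.1, twins z hz x hx h2⟩
      · exact ⟨z, hz, y, hy, hzn.2, twins z hz y hy (by tauto)⟩
    · -- nonadjacent vertices of a complete multipartite graph are twins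
      push Not at hcl
      obtain ⟨u, hu, v, hv, huv, hnuv⟩ := hcl
      refine ⟨u, hu, v, hv, huv, splitIn_pair fun z hz hzu hzv => ⟨fun h => ?_, fun h => ?_⟩⟩
      · exact multipartite v (Or.inr hv) u (Or.inr hu) z hz h huv.symm hzv.symm
          fun h => hnuv h.symm
      · exact multipartite u (Or.inr hu) v (Or.inr hv) z hz h huv hzu.symm hnuv
  refine ⟨x, y, hxy, ?_⟩
  rwa [← hs.antisymm (Set.insert_subset hx (Set.singleton_subset_iff.2 hy))]

/-- Some vertex `x` is pendant at another vertex `v` (then `tw` is false), or a true or false twin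
of it (then `tw` is true). -/
theorem WalksMeetCommonNeighbors.exists_pendant_or_twin [Finite V]
    (hG : G.WalksMeetCommonNeighbors) (hc : G.Connected) (hV : 3 ≤ Nat.card V) :
    ∃ (x v : V) (tw : Prop), x ≠ v ∧ (tw ∨ G.Adj x v) ∧
      ∀ z, z ≠ x → z ≠ v → (G.Adj x z ↔ tw ∧ G.Adj v z) := by
  obtain ⟨x, y, hxy, hs⟩ := hG.exists_splitIn_pair hc hV
  have pendant : ∀ x y : V, x ≠ y → (∀ z, z ≠ x → z ≠ y → ¬ G.Adj x z) → ∃ (x v : V) (tw : Prop),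
      x ≠ v ∧ (tw ∨ G.Adj x v) ∧ ∀ z, z ≠ x → z ≠ v → (G.Adj x z ↔ tw ∧ G.Adj v z) := by
    intro x y hxy h
    refine ⟨x, y, False, hxy, Or.inr ?_, fun z hzx hzy => by simpa using h z hzx hzy⟩
    obtain ⟨w⟩ := hc x y
    cases w with
    | nil => exact absurd rfl hxy
    | @cons _ z _ hxz _ =>
      by_contra hn
      exact h z hxz.ne' (by rintro rfl; exact hn hxz) hxz
  by_cases h1 : ∀ z, z ≠ x → z ≠ y → ¬ G.Adj x z
  · exact pendant x y hxy h1
  by_cases h2 : ∀ z, z ≠ y → z ≠ x → ¬ G.Adj y z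
  · exact pendant y x hxy.symm h2
  push Not at h1 h2
  obtain ⟨z, hzx, hzy, hxz⟩ := h1
  obtain ⟨z', hzy', hzx', hyz'⟩ := h2
  refine ⟨x, y, True, hxy, Or.inl trivial, fun t htx hty => ?_⟩
  rw [true_and]
  have nm : ∀ {s}, s ≠ x → s ≠ y → s ∉ ({x, y} : Set V) := by simp +contextual
  exact ⟨fun h => hs (by simp) (by simp) trivial (nm hzx' hzy') trivial (nm htx hty) hyz' h,
    fun h => hs (by simp) (by simp) trivial (nm hzx hzy) trivial (nm htx hty) hxz h⟩

end SimpleGraph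

/-! ### First steps in trees and accessibility -/

namespace SimpleGraph

variable {V : Type u} {G : SimpleGraph V}

/-- `G.FirstStep v y w` says that one can walk from `v` to `y` by a first step to `w` and without
returning to `v`. In a tree, `w` is then the neighbour of `v` on the path to `y`. -/
def FirstStep (G : SimpleGraph V) (v y w : V) : Prop :=
  G.Adj v w ∧ ∃ p : G.Walk w y, v ∉ p.support

theorem FirstStep.ne {v y w : V} (h : G.FirstStep v y w) : v ≠ y := by
  rintro rfl
  obtain ⟨-, p, hp⟩ := h
  exact hp p.end_mem_support

theorem Adj.firstStep {v w : V} (h : G.Adj v w) : G.FirstStep v w w :=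
  ⟨h, .nil, by simpa using h.ne⟩

theorem FirstStep.append {v y w z : V} (h : G.FirstStep v y w) (p : G.Walk y z)
    (hp : v ∉ p.support) : G.FirstStep v z w := by
  obtain ⟨h1, q, hq⟩ := h
  exact ⟨h1, q.append p, by simp [Walk.mem_support_append_iff, hp, hq]⟩

theorem Connected.exists_firstStep (hG : G.Connected) {v y : V} (h : v ≠ y) :
    ∃ w, G.FirstStep v y w := by
  obtain ⟨p, hp⟩ := hG.exists_isPath v y
  cases p with
  | nil => exact absurd rfl h
  | cons h q => exact ⟨_, h, q, ((Walk.cons_isPath_iff _ _).1 hp).2⟩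

theorem IsTree.firstStep_unique (hG : G.IsTree) {v y w w' : V} (h : G.FirstStep v y w)
    (h' : G.FirstStep v y w') : w = w' := by
  classical
  obtain ⟨hw, p, hp⟩ := h
  obtain ⟨hw', p', hp'⟩ := h'
  have h1 : (Walk.cons hw p.bypass).IsPath :=
    (Walk.cons_isPath_iff _ _).2 ⟨p.bypass_isPath, fun h => hp (p.support_bypass_subset_support h)⟩
  have h2 : (Walk.cons hw' p'.bypass).IsPath :=
    (Walk.cons_isPath_iff _ _).2 ⟨p'.bypass_isPath, fun h => hp' (p'.support_bypass_subset_support h)⟩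
  have := (hG.existsUnique_path v y).unique h1 h2
  simpa using congrArg Walk.snd this

/-- If `v` and `y` lie in different branches at `m`, then the path from `v` to `y` passes
through `m`. -/
theorem IsTree.firstStep_of_ne (hG : G.IsTree) {m v y a b c : V} (hv : G.FirstStep m v a)
    (hy : G.FirstStep m y b) (hab : a ≠ b) (hc : G.FirstStep v m c) : G.FirstStep v y c := by
  classical
  obtain ⟨p, hp⟩ := hG.connected.exists_isPath m y
  refine hc.append p fun hvp => hab ?_
  -- otherwise `v` lies on the path from `m` to `y`, hence in the same branch as `y`
  obtain ⟨q, r, -, -, rfl⟩ := hp.mem_support_iff_exists_append.1 hvp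
  exact hG.firstStep_unique (hv.append r fun hmr =>
    hp.ne_of_mem_support_of_append hv.ne q.start_mem_support hmr rfl) hy

theorem Walk.IsPath.firstStep_of_mem_edges {l u v w : V} {p : G.Walk l u} (hp : p.IsPath)
    (h : s(v, w) ∈ p.edges) : G.FirstStep v l w ∨ G.FirstStep v u w := by
  induction p with
  | nil => simp at h
  | @cons l b u hlb q ih =>
    obtain ⟨hq, hl⟩ := (Walk.cons_isPath_iff _ _).1 hp
    rw [Walk.edges_cons, List.mem_cons] at h
    rcases h with h | h
    · rcases Sym2.eq_iff.1 h with ⟨rfl, rfl⟩ | ⟨rfl, rfl⟩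
      · exact Or.inr ⟨hlb, q, hl⟩
      · exact Or.inl hlb.symm.firstStep
    · refine (ih hq h).imp_left fun hb => hb.append (.cons hlb.symm .nil) ?_
      have hvl : v ≠ l := fun e => hl (e ▸ q.fst_mem_support_of_mem_edges h)
      simp [hb.ne, hvl]

/-- The first edge of a path from `v` to `y`. -/
theorem IsTree.mem_edges_of_firstStep (hG : G.IsTree) {v y w : V} (h : G.FirstStep v y w)
    {p : G.Walk v y} (hp : p.IsPath) : s(v, w) ∈ p.edges := by
  cases p with
  | nil => exact absurd rfl h.ne
  | cons hb q =>
    rw [hG.firstStep_unique h ⟨hb, q, ((Walk.cons_isPath_iff _ _).1 hp).2⟩]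
    simp

end SimpleGraph

namespace GraphLabelledTree

variable {T : GraphLabelledTree.{u}}

/-- Adjacency in the label of `v`, as a relation on all vertices of the tree. -/
def LabelAdj (T : GraphLabelledTree.{u}) (v w w' : T.Vert) : Prop :=
  ∃ (hw : T.tree.Adj v w) (hw' : T.tree.Adj v w'), (T.label v).Adj ⟨w, hw⟩ ⟨w', hw'⟩

theorem LabelAdj.symm {v w w' : T.Vert} (h : T.LabelAdj v w w') : T.LabelAdj v w' w := by
  obtain ⟨hw, hw', h⟩ := h
  exact ⟨hw', hw, h.symm⟩

/-- Accessibility is a condition on each vertex `v` of the tree: if `l` and `u` lie in different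
branches at `v`, then the marker vertices of these branches are adjacent. -/
theorem isAccessible_iff {l u : T.Vert} :
    T.IsAccessible l u ↔ u ≠ l ∧ ∀ v w w', w ≠ w' → T.tree.FirstStep v l w →
      T.tree.FirstStep v u w' → T.LabelAdj v w w' := by
  refine and_congr_right fun _ => ⟨fun h v w w' hne hw hw' => ?_, ?_⟩
  · obtain ⟨p, hp⟩ := T.isTree.connected.exists_isPath l u
    have hv : v ∈ p.support := by
      by_contra hv
      exact hne (T.isTree.firstStep_unique (hw.append p hv) hw')
    obtain ⟨q, r, hq, hr, rfl⟩ := hp.mem_support_iff_exists_append.1 hv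
    refine ⟨hw.1, hw'.1, h _ hp v w w' hw.1 hw'.1 hne ?_ ?_⟩
    · have := T.isTree.mem_edges_of_firstStep hw hq.reverse
      rw [SimpleGraph.Walk.edges_reverse, List.mem_reverse] at this
      simp [this]
    · simp [T.isTree.mem_edges_of_firstStep hw' hr]
  · intro h p hp v w w' hw hw' hne he he'
    have key : T.LabelAdj v w w' := by
      rcases hp.firstStep_of_mem_edges he with h1 | h1 <;>
        rcases hp.firstStep_of_mem_edges he' with h2 | h2
      · exact absurd (T.isTree.firstStep_unique h1 h2) hne
      · exact h v w w' hne h1 h2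
      · exact (h v w' w hne.symm h2 h1).symm
      · exact absurd (T.isTree.firstStep_unique h1 h2) hne
    exact key.2.2

theorem IsAccessible.symm {l u : T.Vert} (h : T.IsAccessible l u) : T.IsAccessible u l := by
  rw [isAccessible_iff] at h ⊢
  exact ⟨h.1.symm, fun v w w' hne hw hw' => (h.2 v w' w hne.symm hw' hw).symm⟩

theorem IsAccessible.labelAdj {l u v w w' : T.Vert} (h : T.IsAccessible l u) (hne : w ≠ w')
    (hw : T.tree.FirstStep v l w) (hw' : T.tree.FirstStep v u w') : T.LabelAdj v w w' :=
  (isAccessible_iff.1 h).2 v w w' hne hw hw'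

theorem IsLeaf.eq_of_firstStep {v l u w w' : T.Vert} (hv : T.IsLeaf v)
    (hw : T.tree.FirstStep v l w) (hw' : T.tree.FirstStep v u w') : w = w' :=
  hv hw.1 hw'.1

/-- In a clique-star tree, a node at which two branches are not joined, but are both joined to a
third branch, is labelled by a star, and this third branch is its centre. -/
theorem IsCliqueStar.eq_of_labelAdj (hT : T.IsCliqueStar) {m a b c d : T.Vert} (hab : a ≠ b)
    (hn : ¬ T.LabelAdj m a b) (hac : T.LabelAdj m a c) (hcb : T.LabelAdj m c b)
    (had : T.LabelAdj m a d) : d = c := by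
  obtain ⟨ha, hc, hac⟩ := hac
  obtain ⟨_, hb, hcb⟩ := hcb
  obtain ⟨_, hd, had⟩ := had
  have hnl : ¬ T.IsLeaf m := fun h => hab (h ha hb)
  rcases hT m hnl with h | ⟨s, hs⟩
  · exact absurd ⟨ha, hb, by rw [h]; exact fun e => hab (congrArg Subtype.val e)⟩ hn
  · have hn' : ¬ (T.label m).Adj ⟨a, ha⟩ ⟨b, hb⟩ := fun h => hn ⟨ha, hb, h⟩
    rw [hs] at hac hcb had hn'
    simp only [ne_eq] at hac hcb had hn'
    grind

section Family

variable {ι : Type u} {𝒯 : ι → GraphLabelledTree.{u}}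

/-- Accessibility of leaves in a family of disjoint trees. -/
def LeafAccessible (𝒯 : ι → GraphLabelledTree.{u}) (l l' : Leaves 𝒯) : Prop :=
  ∃ (i : ι) (a b : (𝒯 i).Vert), l.1 = ⟨i, a⟩ ∧ l'.1 = ⟨i, b⟩ ∧ (𝒯 i).IsAccessible a b

theorem nonempty_inter_accessibilitySet {l l' : Leaves 𝒯} (hne : l ≠ l') :
    (accessibilitySet 𝒯 l ∩ accessibilitySet 𝒯 l').Nonempty ↔ LeafAccessible 𝒯 l l' := by
  obtain ⟨⟨i, a⟩, ha⟩ := l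
  obtain ⟨⟨j, b⟩, hb⟩ := l'
  constructor
  · rintro ⟨e, ⟨a', -, haa', rfl⟩, ⟨b', -, hbb', he⟩⟩
    rcases Sym2.eq_iff.1 he with ⟨h, -⟩ | ⟨-, h⟩
    · exact absurd (Subtype.ext h) hne
    · exact ⟨i, a, a', rfl, h.symm, haa'⟩
  · rintro ⟨k, a', b', h1, h2, h⟩
    obtain ⟨rfl, h1⟩ := Sigma.mk.inj h1
    obtain rfl := eq_of_heq h1
    obtain ⟨rfl, h2⟩ := Sigma.mk.inj h2
    obtain rfl := eq_of_heq h2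
    exact ⟨_, ⟨b, hb, h, rfl⟩, ⟨a, ha, h.symm, Sym2.eq_swap⟩⟩

end Family

end GraphLabelledTree

/-! ### Accessibility graphs are distance hereditary -/

namespace GraphLabelledTree

variable {T : GraphLabelledTree.{u}}

/-- Let `a`, `b` be vertices that are not accessible from each other, but both accessible from a
leaf `c`. The path from `a` to `b` is interrupted at the node `m` where the path from `c` joins it,
and `m` is labelled by a star with centre towards `c`. Hence an accessible pair `p`, `q` that
leaves the branch of `a` at `m` does so through `m` and into the branch of `c`, which makes `q`
accessible from both `a` and `b`. -/
theorem IsCliqueStar.exists_separating_node (hT : T.IsCliqueStar) {a b c : T.Vert}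
    (hc : T.IsLeaf c) (hne : b ≠ a)
    (hab : ¬ T.IsAccessible a b) (hac : T.IsAccessible a c) (hcb : T.IsAccessible c b) :
    ∃ m w, ¬ T.IsLeaf m ∧ T.tree.FirstStep m a w ∧ ¬ T.tree.FirstStep m b w ∧
      ∀ p q, T.IsLeaf p → T.IsLeaf q → T.IsAccessible p q → T.tree.FirstStep m p w →
        ¬ T.tree.FirstStep m q w → T.IsAccessible a q ∧ T.IsAccessible q b := by
  have uniq : ∀ {v y w w'}, T.tree.FirstStep v y w → T.tree.FirstStep v y w' → w = w' :=
    fun h h' => T.isTree.firstStep_unique h h'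
  have step : ∀ {v y}, v ≠ y → ∃ w, T.tree.FirstStep v y w :=
    fun h => T.isTree.connected.exists_firstStep h
  have leaf_ne : ∀ {v l}, ¬ T.IsLeaf v → T.IsLeaf l → v ≠ l := by
    rintro v l hv hl rfl
    exact hv hl
  rw [isAccessible_iff] at hab
  push Not at hab
  obtain ⟨m, wa, wb, hwab, hma, hmb, hnab⟩ := hab hne
  have hm : ¬ T.IsLeaf m := fun h => hwab (h hma.1 hmb.1)
  obtain ⟨wc, hmc⟩ := step (leaf_ne hm hc)
  have hwac : wa ≠ wc := by
    rintro rfl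
    exact hnab (hcb.labelAdj hwab hmc hmb)
  have hwcb : wc ≠ wb := by
    rintro rfl
    exact hnab (hac.labelAdj hwab hma hmc)
  have hlac := hac.labelAdj hwac hma hmc
  have hlcb := hcb.labelAdj hwcb hmc hmb
  refine ⟨m, wa, hm, hma, fun h => hwab (uniq h hmb), fun p q hp hq hpq hmp hmq => ?_⟩
  obtain ⟨wq, hmq'⟩ := step (leaf_ne hm hq)
  have hwaq : wa ≠ wq := by
    rintro rfl
    exact hmq hmq'
  obtain rfl : wq = wc := hT.eq_of_labelAdj hwab hnab hlac hlcb (hpq.labelAdj hwaq hmp hmq')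
  have hqa : q ≠ a := by
    rintro rfl
    exact hmq hma
  have hbq : b ≠ q := by
    rintro rfl
    exact hwcb (uniq hmq' hmb)
  -- If `v` is not in the branch of `y` at `m`, then the branch of `y` at `v` is that of `m`.
  have via : ∀ {v y wv wy wm : T.Vert}, T.tree.FirstStep v m wm → T.tree.FirstStep m v wv →
      T.tree.FirstStep m y wy → wv ≠ wy → T.tree.FirstStep v y wm :=
    fun h1 h2 h3 h4 => T.isTree.firstStep_of_ne h2 h3 h4 h1
  constructor
  · refine isAccessible_iff.2 ⟨hqa, fun v w w' hww hw hw' => ?_⟩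
    have hv : ¬ T.IsLeaf v := fun h => hww (h hw.1 hw'.1)
    by_cases hvm : v = m
    · subst hvm
      rwa [uniq hw hma, uniq hw' hmq']
    obtain ⟨wm, hvm'⟩ := step hvm
    obtain ⟨wv, hmv⟩ := step (Ne.symm hvm)
    by_cases h : wv = wa
    · subst h
      obtain rfl := uniq (via hvm' hmv hmq' hwac) hw'
      exact hac.labelAdj hww hw (via hvm' hmv hmc hwac)
    · obtain rfl := uniq (via hvm' hmv hma h) hw
      exact hpq.labelAdj hww (via hvm' hmv hmp h) hw'
  · refine isAccessible_iff.2 ⟨hbq, fun v w w' hww hw hw' => ?_⟩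
    have hv : ¬ T.IsLeaf v := fun h => hww (h hw.1 hw'.1)
    by_cases hvm : v = m
    · subst hvm
      rwa [uniq hw hmq', uniq hw' hmb]
    obtain ⟨wm, hvm'⟩ := step hvm
    obtain ⟨wv, hmv⟩ := step (Ne.symm hvm)
    by_cases h : wv = wq
    · subst h
      obtain rfl := uniq (via hvm' hmv hmb hwcb) hw'
      exact (hpq.symm).labelAdj hww hw (via hvm' hmv hmp hwac.symm)
    · obtain rfl := uniq (via hvm' hmv hmq' h) hw
      exact hcb.labelAdj hww (via hvm' hmv hmc h) hw'

/-- Intersection graphs of accessibility sets in clique-star trees have the walk property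
equivalent to distance heredity. -/
theorem walksMeetCommonNeighbors_intersectionGraph {V ι : Type u} {𝒯 : ι → GraphLabelledTree.{u}}
    (h𝒯 : ∀ i, (𝒯 i).IsCliqueStar) (leafOf : V → Leaves 𝒯) :
    (intersectionGraph fun v => accessibilitySet 𝒯 (leafOf v)).WalksMeetCommonNeighbors := by
  set G := intersectionGraph fun v => accessibilitySet 𝒯 (leafOf v)
  have adj_iff : ∀ {x y}, leafOf x ≠ leafOf y →
      (G.Adj x y ↔ LeafAccessible 𝒯 (leafOf x) (leafOf y)) := by
    intro x y h
    rw [← nonempty_inter_accessibilitySet h]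
    exact and_iff_right fun e => h (congrArg leafOf e)
  intro x r z hxr hnadj hxz hzr w
  -- Vertices that share a leaf are twins, so the three leaves are distinct.
  have hxz' : leafOf x ≠ leafOf z := fun h => hnadj ⟨hxr, by simpa only [h] using hzr.2⟩
  have hzr' : leafOf z ≠ leafOf r := fun h => hnadj ⟨hxr, by simpa only [h] using hxz.2⟩
  have hxr' : leafOf x ≠ leafOf r := fun h => hnadj ⟨hxr, by
    simpa only [h, Set.inter_self] using hxz.2.mono Set.inter_subset_left⟩
  obtain ⟨i, a, c, hxa, hzc, hac⟩ := (adj_iff hxz').1 hxz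
  obtain ⟨j, c', b, hzc', hrb, hcb⟩ := (adj_iff hzr').1 hzr
  rw [hzc] at hzc'
  obtain ⟨rfl, h⟩ := Sigma.mk.inj hzc'
  obtain rfl := eq_of_heq h
  have leaf : ∀ {x a}, (leafOf x).1 = ⟨i, a⟩ → (𝒯 i).IsLeaf a := by
    intro x a h
    have := (leafOf x).2
    rwa [h] at this
  have hba : b ≠ a := by
    rintro rfl
    exact hxr' (Subtype.ext (hxa.trans hrb.symm))
  obtain ⟨m, s, hm, hma, hmb, hsep⟩ := (h𝒯 i).exists_separating_node (leaf hzc) hba (fun h => hnadj ((adj_iff hxr').2 ⟨i, a, b, hxa, hrb, h⟩)) hac hcb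
  have vert : ∀ {v w w'}, (leafOf v).1 = ⟨i, w⟩ → (leafOf v).1 = ⟨i, w'⟩ → w = w' :=
    fun h h' => eq_of_heq (Sigma.mk.inj (h.symm.trans h')).2
  obtain ⟨p, q, p', hp', hpq, hq, hqw⟩ := w.exists_first_exit
    (S := {v | ∃ y, (leafOf v).1 = ⟨i, y⟩ ∧ (𝒯 i).tree.FirstStep m y s}) ⟨a, hxa, hma⟩ (by
      rintro ⟨y, hy, hmy⟩
      exact hmb (vert hrb hy ▸ hmy))
  obtain ⟨y, hy, hmy⟩ := hp' p p'.end_mem_support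
  have hpq' : leafOf p ≠ leafOf q := fun h => hq ⟨y, h ▸ hy, hmy⟩
  obtain ⟨k, y', u, hy', hu, hyu⟩ := (adj_iff hpq').1 hpq
  rw [hy] at hy'
  obtain ⟨rfl, h⟩ := Sigma.mk.inj hy'
  obtain rfl := eq_of_heq h
  obtain ⟨h1, h2⟩ := hsep y u (leaf hy) (leaf hu) hyu hmy fun h => hq ⟨u, hu, h⟩
  refine ⟨q, hqw, (adj_iff fun h => ?_).2 ⟨i, a, u, hxa, hu, h1⟩,
    (adj_iff fun h => ?_).2 ⟨i, u, b, hu, hrb, h2⟩⟩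
  · exact h1.1 (vert (h ▸ hu) hxa)
  · exact h2.1 (vert hrb (h ▸ hu))

end GraphLabelledTree

/-! ### Attaching two leaves to a graph-labelled tree -/

namespace SimpleGraph

variable {V : Type u} {G : SimpleGraph V}

/-- The graph obtained from `G` by attaching two new vertices of degree one at `v₀`. -/
def attachTwo (G : SimpleGraph V) (v₀ : V) : SimpleGraph (V ⊕ Bool) where
  Adj
    | .inl a, .inl b => G.Adj a b
    | .inl a, .inr _ => a = v₀
    | .inr _, .inl b => b = v₀
    | .inr _, .inr _ => False
  symm := ⟨by
    rintro (a | a) (b | b) h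
    exacts [SimpleGraph.Adj.symm h, h, h, h]⟩
  loopless := ⟨by
    rintro (a | a) h
    exacts [SimpleGraph.Adj.ne h rfl, h]⟩

variable {v₀ : V}

@[simp] theorem attachTwo_adj_inl_inr {a : V} {k : Bool} :
    (G.attachTwo v₀).Adj (.inl a) (.inr k) ↔ a = v₀ := Iff.rfl

@[simp] theorem not_attachTwo_adj_inr_inr {k k' : Bool} :
    ¬ (G.attachTwo v₀).Adj (.inr k) (.inr k') := id

/-- The inclusion of `G` into `G.attachTwo v₀`. -/
def attachTwoInl (G : SimpleGraph V) (v₀ : V) : G ↪g G.attachTwo v₀ where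
  toFun := .inl
  inj' := Sum.inl_injective
  map_rel_iff' := Iff.rfl

theorem FirstStep.attachTwo {v y w : V} (h : G.FirstStep v y w) :
    (G.attachTwo v₀).FirstStep (.inl v) (.inl y) (.inl w) := by
  obtain ⟨h1, p, hp⟩ := h
  refine ⟨h1, p.map (G.attachTwoInl v₀).toHom, fun hv => hp ?_⟩
  obtain ⟨s, hs, e⟩ := List.mem_map.1
    ((congrArg (Sum.inl v ∈ ·) (Walk.support_map (G.attachTwoInl v₀).toHom p)).mp hv)
  exact Sum.inl_injective e ▸ hs

theorem FirstStep.attachTwo_inr {v w : V} (h : G.FirstStep v v₀ w) (k : Bool) :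
    (G.attachTwo v₀).FirstStep (.inl v) (.inr k) (.inl w) := by
  refine h.attachTwo.append (.cons (v := Sum.inr k) (by simp) .nil) ?_
  simpa using h.ne

theorem firstStep_attachTwo_self (k : Bool) :
    (G.attachTwo v₀).FirstStep (.inl v₀) (.inr k) (.inr k) :=
  Adj.firstStep (by simp)

/-- In `G.attachTwo v₀`, every edge is a bridge: a new one because it is pendant, an old one because
the new vertices can be contracted to `v₀`. -/
theorem IsTree.attachTwo (hG : G.IsTree) (v₀ : V) : (G.attachTwo v₀).IsTree where
  connected := by
    have hinl : ∀ a b : V, (G.attachTwo v₀).Reachable (.inl a) (.inl b) := fun a b =>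
      (hG.connected a b).map (G.attachTwoInl v₀).toHom
    have hinr : ∀ k : Bool, (G.attachTwo v₀).Reachable (.inl v₀) (.inr k) := fun k =>
      Adj.reachable (by simp)
    have h : ∀ x, (G.attachTwo v₀).Reachable (.inl v₀) x := by
      rintro (a | k)
      exacts [hinl v₀ a, hinr k]
    exact { preconnected := fun x y => (h x).symm.trans (h y), nonempty := ⟨.inl v₀⟩ }
  isAcyclic := by
    rw [isAcyclic_iff_forall_adj_isBridge]
    have pendant : ∀ k, (G.attachTwo v₀).IsBridge s(.inl v₀, .inr k) := by
      intro k
      rw [isBridge_iff]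
      rintro ⟨p⟩
      cases p.reverse with
      | @cons _ b _ h _ =>
        rw [deleteEdges_adj] at h
        rcases b with b | b
        · obtain rfl : b = v₀ := h.1
          exact h.2 Sym2.eq_swap
        · exact h.1
    rintro (a | k) (b | k') h
    · have hb := isAcyclic_iff_forall_adj_isBridge.1 hG.isAcyclic h
      rw [isBridge_iff] at hb ⊢
      rintro ⟨p⟩
      have retract : ∀ {x y : V ⊕ Bool},
          ((G.attachTwo v₀).deleteEdges {s(.inl a, .inl b)}).Walk x y →
          (G.deleteEdges {s(a, b)}).Reachable (x.elim id fun _ => v₀) (y.elim id fun _ => v₀) := by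
        intro x y p
        induction p with
        | nil => exact .rfl
        | @cons x z _ hxz _ ih =>
          refine Reachable.trans ?_ ih
          rw [deleteEdges_adj] at hxz
          rcases x with x | x <;> rcases z with z | z
          · refine Adj.reachable ((deleteEdges_adj).2 ⟨hxz.1, fun h => hxz.2 ?_⟩)
            have h : s(x, z) = s(a, b) := h
            exact congrArg (Sym2.map Sum.inl) h
          · obtain rfl : x = v₀ := hxz.1
            exact .rfl
          · obtain rfl : z = v₀ := hxz.1
            exact .rfl
          · exact absurd hxz.1 not_attachTwo_adj_inr_inr
      exact hb (retract p)
    · obtain rfl : a = v₀ := h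
      exact pendant k'
    · obtain rfl : b = v₀ := h
      rw [Sym2.eq_swap]
      exact pendant k
    · exact absurd h not_attachTwo_adj_inr_inr

end SimpleGraph

namespace GraphLabelledTree

variable {T : GraphLabelledTree.{u}} {v₀ : T.Vert} {tw adj : Prop}

/-- The labels of `T.extend v₀ tw adj`, as a relation on all vertices. It does not depend on `v₀`,
since a new vertex is a marker vertex at `v₀` only, and the new vertices are leaves. -/
def extendLabel (T : GraphLabelledTree.{u}) (tw adj : Prop) :
    T.Vert ⊕ Bool → T.Vert ⊕ Bool → T.Vert ⊕ Bool → Prop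
  | .inl v, .inl w, .inl w' => T.LabelAdj v w w'
  | .inl _, .inl _, .inr k => k = true → tw
  | .inl _, .inr k, .inl _ => k = true → tw
  | .inl _, .inr k, .inr k' => k ≠ k' ∧ adj
  | .inr _, _, _ => False

/-- The leaf `v₀` of `T` is turned into a node with two new leaves, of which `inr false` takes the
place of `v₀`, and `inr true` represents a new vertex. The latter is a twin of the former if `tw`
holds, otherwise it has no neighbours among the old leaves; the two are adjacent if `adj` holds. -/
abbrev extend (T : GraphLabelledTree.{u}) (v₀ : T.Vert) (tw adj : Prop) :
    GraphLabelledTree.{u} where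
  Vert := T.Vert ⊕ Bool
  finite_vert := by
    have := T.finite_vert
    infer_instance
  tree := T.tree.attachTwo v₀
  isTree := T.isTree.attachTwo v₀
  label v :=
    { Adj := fun w w' => T.extendLabel tw adj v w w'
      symm := ⟨by
        rintro ⟨w, _⟩ ⟨w', _⟩ h
        rcases v with v | v <;> rcases w with w | w <;> rcases w' with w' | w'
        exacts [LabelAdj.symm h, h, h, ⟨h.1.symm, h.2⟩, h, h, h, h]⟩
      loopless := ⟨by
        rintro ⟨w, _⟩ h
        rcases v with v | v <;> rcases w with w | w
        · exact h.2.2.ne rfl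
        · exact h.1 rfl
        · exact h
        · exact h⟩ }

theorem labelAdj_extend {v w w' : T.Vert ⊕ Bool} (hw : (T.tree.attachTwo v₀).Adj v w)
    (hw' : (T.tree.attachTwo v₀).Adj v w') :
    (T.extend v₀ tw adj).LabelAdj v w w' ↔ T.extendLabel tw adj v w w' :=
  ⟨fun ⟨_, _, h⟩ => h, fun h => ⟨hw, hw', h⟩⟩

theorem extend_isLeaf_inr (k : Bool) : (T.extend v₀ tw adj).IsLeaf (.inr k) := by
  rintro (a | a) ha (b | b) hb
  · obtain rfl : a = v₀ := ha
    obtain rfl : b = a := hb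
    rfl
  · exact hb.elim
  · exact ha.elim
  · exact ha.elim

theorem extend_isLeaf_inl {v : T.Vert} :
    (T.extend v₀ tw adj).IsLeaf (.inl v) ↔ v ≠ v₀ ∧ T.IsLeaf v := by
  constructor
  · intro h
    refine ⟨?_, fun a ha b hb => ?_⟩
    · rintro rfl
      have : (Sum.inr false : T.Vert ⊕ Bool) = Sum.inr true := h rfl rfl
      simp at this
    · have : (Sum.inl a : T.Vert ⊕ Bool) = Sum.inl b := h ha hb
      exact Sum.inl_injective this
  · rintro ⟨hne, h⟩ (a | a) ha (b | b) hb
    · exact congrArg Sum.inl (h ha hb)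
    · exact absurd hb hne
    · exact absurd ha hne
    · exact absurd ha hne

theorem label_eq_top_iff {v : T.Vert} : T.label v = ⊤ ↔
    ∀ a b, T.tree.Adj v a → T.tree.Adj v b → a ≠ b → T.LabelAdj v a b := by
  constructor
  · intro h a b ha hb hab
    exact ⟨ha, hb, by rw [h]; exact fun e => hab (congrArg Subtype.val e)⟩
  · intro h
    ext ⟨a, ha⟩ ⟨b, hb⟩
    exact ⟨fun h => h.ne, fun hab => (h a b ha hb fun e => hab (Subtype.ext e)).2.2⟩

theorem label_isStar_iff {v : T.Vert} : (T.label v).IsStar ↔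
    ∃ c, T.tree.Adj v c ∧ ∀ a b, T.tree.Adj v a → T.tree.Adj v b →
      (T.LabelAdj v a b ↔ a ≠ b ∧ (a = c ∨ b = c)) := by
  constructor
  · rintro ⟨⟨c, hc⟩, h⟩
    refine ⟨c, hc, fun a b ha hb => ?_⟩
    have := h ⟨a, ha⟩ ⟨b, hb⟩
    simp only [ne_eq, Subtype.ext_iff] at this
    exact ⟨fun ⟨_, _, h⟩ => this.1 h, fun h => ⟨ha, hb, this.2 h⟩⟩
  · rintro ⟨c, hc, h⟩
    refine ⟨⟨c, hc⟩, fun a b => ?_⟩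
    simp only [ne_eq, Subtype.ext_iff]
    exact ⟨fun hab => (h a b a.2 b.2).1 ⟨a.2, b.2, hab⟩,
      fun hab => ((h a b a.2 b.2).2 hab).2.2⟩

/-- The new node is labelled by a triangle for true twins, by a star with centre towards the old
tree for false twins, and by a star with centre towards the old leaf for a pendant vertex. -/
theorem IsCliqueStar.extend (hT : T.IsCliqueStar) (hv₀ : T.IsLeaf v₀) {p : T.Vert}
    (hp : T.tree.Adj v₀ p) (h : tw ∨ adj) : (T.extend v₀ tw adj).IsCliqueStar := by
  classical
  rintro (v | k) hv
  swap
  · exact absurd (extend_isLeaf_inr k) hv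
  by_cases hvv : v = v₀
  · subst hvv
    have only : ∀ {w}, T.tree.Adj v w → w = p := fun hw => hv₀ hw hp
    have hlab : ∀ {w w'}, ¬ T.LabelAdj v w w' := fun ⟨h1, h2, h⟩ =>
      h.ne (Subtype.ext (hv₀ h1 h2))
    by_cases hall : tw ∧ adj
    · left
      rw [label_eq_top_iff]
      rintro (a | a) (b | b) ha hb hab
      · exact absurd (congrArg Sum.inl (hv₀ ha hb)) hab
      · exact (labelAdj_extend ha hb).2 fun _ => hall.1
      · exact (labelAdj_extend ha hb).2 fun _ => hall.1
      · exact (labelAdj_extend ha hb).2 ⟨fun e => hab (congrArg Sum.inr e), hall.2⟩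
    · right
      rw [label_isStar_iff]
      refine ⟨if tw then .inl p else .inr false, ?_, ?_⟩
      · split_ifs
        exacts [hp, rfl]
      · rintro (a | a) (b | b) ha hb <;> rw [labelAdj_extend ha hb]
        · obtain rfl := only ha
          obtain rfl := only hb
          simpa [extendLabel] using hlab
        · obtain rfl := only ha
          by_cases tw <;> cases b <;> simp_all [extendLabel]
        · obtain rfl := only hb
          by_cases tw <;> cases a <;> simp_all [extendLabel]
        · by_cases tw <;> cases a <;> cases b <;> simp_all [extendLabel]
  · have hnl : ¬ T.IsLeaf v := fun h => hv (extend_isLeaf_inl.2 ⟨hvv, h⟩)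
    refine (hT v hnl).imp ?_ ?_
    · rw [label_eq_top_iff, label_eq_top_iff]
      rintro h (a | a) (b | b) ha hb hab
      · exact (labelAdj_extend ha hb).2 (h a b ha hb fun e => hab (congrArg Sum.inl e))
      · exact absurd hb hvv
      · exact absurd ha hvv
      · exact absurd ha hvv
    · rw [label_isStar_iff, label_isStar_iff]
      rintro ⟨c, hc, h⟩
      refine ⟨.inl c, hc, ?_⟩
      rintro (a | a) (b | b) ha hb
      · rw [labelAdj_extend ha hb]
        exact (h a b ha hb).trans (by simp)
      · exact absurd hb hvv
      · exact absurd ha hvv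
      · exact absurd ha hvv

/-- First steps in the extended tree from an old vertex are old, except from `v₀` itself. -/
theorem firstStep_inl_of_extend {v y : T.Vert} {w : T.Vert ⊕ Bool} (hvy : v ≠ y)
    (h : (T.tree.attachTwo v₀).FirstStep (.inl v) (.inl y) w) :
    ∃ w', w = .inl w' ∧ T.tree.FirstStep v y w' := by
  obtain ⟨w', hw'⟩ := T.isTree.connected.exists_firstStep hvy
  exact ⟨w', (T.isTree.attachTwo v₀).firstStep_unique h hw'.attachTwo, hw'⟩

theorem firstStep_inr_of_extend {v : T.Vert} {k : Bool} {w : T.Vert ⊕ Bool}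
    (h : (T.tree.attachTwo v₀).FirstStep (.inl v) (.inr k) w) :
    (v = v₀ ∧ w = .inr k) ∨ ∃ w', w = .inl w' ∧ T.tree.FirstStep v v₀ w' := by
  by_cases hv : v = v₀
  · subst hv
    exact Or.inl ⟨rfl, (T.isTree.attachTwo v).firstStep_unique h
      (SimpleGraph.firstStep_attachTwo_self k)⟩
  · obtain ⟨w', hw'⟩ := T.isTree.connected.exists_firstStep hv
    exact Or.inr ⟨w', (T.isTree.attachTwo v₀).firstStep_unique h (hw'.attachTwo_inr k), hw'⟩

theorem extend_isAccessible_inl_inl {l u : T.Vert} :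
    (T.extend v₀ tw adj).IsAccessible (.inl l) (.inl u) ↔ T.IsAccessible l u := by
  rw [isAccessible_iff, isAccessible_iff]
  refine and_congr Sum.inl_injective.ne_iff ⟨fun h v w w' hne hw hw' => ?_, ?_⟩
  · exact (labelAdj_extend (v₀ := v₀) (tw := tw) (adj := adj) hw.attachTwo.1 hw'.attachTwo.1).1
      (h (.inl v) (.inl w) (.inl w') (Sum.inl_injective.ne hne) hw.attachTwo hw'.attachTwo)
  · rintro h (v | k) w w' hne hw hw'
    · obtain ⟨w, rfl, hw1⟩ := firstStep_inl_of_extend (fun e => hw.ne (congrArg Sum.inl e)) hw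
      obtain ⟨w', rfl, hw1'⟩ := firstStep_inl_of_extend (fun e => hw'.ne (congrArg Sum.inl e)) hw'
      exact (labelAdj_extend hw.1 hw'.1).2 (h v w w' (fun e => hne (congrArg Sum.inl e)) hw1 hw1')
    · exact absurd ((extend_isLeaf_inr k).eq_of_firstStep hw hw') hne

theorem extend_isAccessible_inr_inl {k : Bool} {u : T.Vert} (hv₀ : T.IsLeaf v₀) (hu : u ≠ v₀) :
    (T.extend v₀ tw adj).IsAccessible (.inr k) (.inl u) ↔
      (k = true → tw) ∧ T.IsAccessible v₀ u := by
  obtain ⟨p, hp⟩ := T.isTree.connected.exists_firstStep hu.symm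
  rw [isAccessible_iff, isAccessible_iff]
  refine ⟨fun ⟨_, h⟩ => ⟨?_, hu, fun v w w' hne hw hw' => ?_⟩, ?_⟩
  · have h1 := SimpleGraph.firstStep_attachTwo_self (G := T.tree) (v₀ := v₀) k
    exact (labelAdj_extend (v₀ := v₀) (tw := tw) (adj := adj) h1.1 hp.attachTwo.1).1
      (h (.inl v₀) (.inr k) (.inl p) Sum.inr_ne_inl h1 hp.attachTwo)
  · exact (labelAdj_extend (v₀ := v₀) (tw := tw) (adj := adj) hw.attachTwo.1 hw'.attachTwo.1).1
      (h (.inl v) (.inl w) (.inl w') (Sum.inl_injective.ne hne) (hw.attachTwo_inr k)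
        hw'.attachTwo)
  · rintro ⟨hk, -, h⟩
    refine ⟨Sum.inl_ne_inr, ?_⟩
    rintro (v | k) w w' hne hw hw'
    · obtain ⟨w', rfl, hw1'⟩ := firstStep_inl_of_extend (fun e => hw'.ne (congrArg Sum.inl e)) hw'
      rcases firstStep_inr_of_extend hw with ⟨rfl, rfl⟩ | ⟨w, rfl, hw1⟩
      · exact (labelAdj_extend hw.1 hw'.1).2 hk
      · exact (labelAdj_extend hw.1 hw'.1).2
          (h v w w' (fun e => hne (congrArg Sum.inl e)) hw1 hw1')
    · exact absurd ((extend_isLeaf_inr k).eq_of_firstStep hw hw') hne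

theorem extend_isAccessible_inr_inr {k k' : Bool} (hk : k ≠ k') :
    (T.extend v₀ tw adj).IsAccessible (.inr k) (.inr k') ↔ adj := by
  rw [isAccessible_iff]
  constructor
  · rintro ⟨-, h⟩
    have h1 := SimpleGraph.firstStep_attachTwo_self (G := T.tree) (v₀ := v₀)
    exact ((labelAdj_extend (v₀ := v₀) (tw := tw) (adj := adj) (h1 k).1 (h1 k').1).1
      (h (.inl v₀) (.inr k) (.inr k') (Sum.inr_injective.ne hk) (h1 k) (h1 k'))).2
  · intro h
    refine ⟨Sum.inr_injective.ne hk.symm, ?_⟩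
    rintro (v | j) w w' hne hw hw'
    · rcases firstStep_inr_of_extend hw with ⟨rfl, rfl⟩ | ⟨w, rfl, hw1⟩
      · rcases firstStep_inr_of_extend hw' with ⟨-, rfl⟩ | ⟨w', rfl, hw1'⟩
        · exact (labelAdj_extend hw.1 hw'.1).2 ⟨hk, h⟩
        · exact absurd rfl hw1'.ne
      · rcases firstStep_inr_of_extend hw' with ⟨rfl, rfl⟩ | ⟨w', rfl, hw1'⟩
        · exact absurd rfl hw1.ne
        · exact absurd (congrArg Sum.inl (T.isTree.firstStep_unique hw1 hw1')) hne
    · exact absurd ((extend_isLeaf_inr j).eq_of_firstStep hw hw') hne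

end GraphLabelledTree

/-! ### Trees for distance hereditary graphs -/

/-- Deleting a vertex `x` all of whose neighbours, except possibly `v`, are neighbours of `v`
preserves connectedness: `x` can be mapped to `v`. -/
theorem SimpleGraph.Connected.induce_compl_singleton {V : Type u} {G : SimpleGraph V}
    (hG : G.Connected) {x v : V} (hxv : x ≠ v)
    (h : ∀ z, z ≠ v → G.Adj x z → G.Adj v z) : (G.induce {x}ᶜ).Connected := by
  classical
  let r : V → ({x}ᶜ : Set V) := fun y => if hy : y = x then ⟨v, hxv.symm⟩ else ⟨y, hy⟩
  have hr : ∀ y : ({x}ᶜ : Set V), r y = y := fun y => dif_neg y.2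
  have hrx : r x = ⟨v, hxv.symm⟩ := dif_pos rfl
  have hrne : ∀ {y}, (hy : y ≠ x) → r y = ⟨y, hy⟩ := fun hy => dif_neg hy
  have toV : ∀ {z}, G.Adj x z → (G.induce {x}ᶜ).Reachable (r x) (r z) := by
    intro z hxz
    rw [hrx, hrne hxz.ne']
    by_cases hzv : z = v
    · subst hzv
      exact .rfl
    · exact Adj.reachable (h z hzv hxz)
  have key : ∀ {y z : V}, G.Walk y z → (G.induce {x}ᶜ).Reachable (r y) (r z) := by
    intro y z w
    induction w with
    | nil => exact .rfl
    | @cons a b _ hab _ ih =>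
      refine Reachable.trans ?_ ih
      by_cases ha : a = x
      · subst ha
        exact toV hab
      by_cases hb : b = x
      · subst hb
        exact (toV hab.symm).symm
      · rw [hrne ha, hrne hb]
        exact Adj.reachable hab
  refine { preconnected := fun a b => ?_, nonempty := ⟨⟨v, hxv.symm⟩⟩ }
  obtain ⟨w⟩ := hG a b
  rw [← hr a, ← hr b]
  exact key w

/-- `f` identifies the vertices of `G` with the leaves of the clique-star tree `T`, and adjacency
in `G` with accessibility in `T`. -/
structure GraphLabelledTree.Represents {V : Type u} (T : GraphLabelledTree.{u})
    (f : V → T.Vert) (G : SimpleGraph V) : Prop where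
  isCliqueStar : T.IsCliqueStar
  injective : Function.Injective f
  isLeaf_iff : ∀ t, T.IsLeaf t ↔ t ∈ Set.range f
  adj_iff : ∀ x y, G.Adj x y ↔ T.IsAccessible (f x) (f y)

namespace SimpleGraph

open GraphLabelledTree

/-- A connected graph with at most two vertices is a tree, and all its vertices are leaves. -/
theorem Connected.exists_represents_of_card_le_two {V : Type u} [Finite V] {G : SimpleGraph V}
    (hc : G.Connected) (hV : Nat.card V ≤ 2) :
    ∃ (T : GraphLabelledTree.{u}) (f : V → T.Vert), T.Represents f G := by
  have hcard : ENat.card V ≤ 2 := by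
    rw [ENat.card_eq_coe_natCard]
    exact_mod_cast hV
  have two : ∀ a b c : V, a ≠ b → a ≠ c → b = c := by
    intro a b c hab hac
    by_contra hbc
    have : ({a, b, c} : Set V).ncard ≤ 2 := (Set.ncard_le_card _).trans hV
    rw [Set.ncard_eq_three.2 ⟨a, b, c, hab, hac, hbc, rfl⟩] at this
    omega
  let T : GraphLabelledTree.{u} :=
    { Vert := V
      finite_vert := inferInstance
      tree := G
      isTree := ⟨hc, .of_card_le_two hcard⟩
      label := fun _ => ⊤ }
  have hleaf : ∀ t : V, T.IsLeaf t := fun t a ha b hb => two t a b ha.ne hb.ne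
  refine ⟨T, id, fun t ht => absurd (hleaf t) ht, Function.injective_id,
    fun t => iff_of_true (hleaf t) ⟨t, rfl⟩, fun x y => ?_⟩
  rw [isAccessible_iff]
  constructor
  · intro hxy
    exact ⟨hxy.ne', fun v w w' hne hw hw' => absurd (hleaf v hw.1 hw'.1) hne⟩
  · rintro ⟨hne, -⟩
    obtain ⟨w, hw⟩ := hc.exists_firstStep (Ne.symm hne)
    rw [two x y w (Ne.symm hne) hw.1.ne]
    exact hw.1

/-- A tree for `G` with the vertex `x` deleted extends to a tree for `G` if `x` is pendant at `v`
or a twin of `v`. -/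
theorem exists_represents_of_induce {V : Type u} {G : SimpleGraph V} {x v u : V} {tw : Prop}
    (hxv : x ≠ v) (hux : u ≠ x) (huv : u ≠ v) (htw : tw ∨ G.Adj x v)
    (hx : ∀ z, z ≠ x → z ≠ v → (G.Adj x z ↔ tw ∧ G.Adj v z)) {T : GraphLabelledTree.{u}}
    {f : ({x}ᶜ : Set V) → T.Vert} (hT : T.Represents f (G.induce {x}ᶜ)) :
    ∃ (T : GraphLabelledTree.{u}) (f : V → T.Vert), T.Represents f G := by
  classical
  let v' : ({x}ᶜ : Set V) := ⟨v, hxv.symm⟩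
  have hleaf : T.IsLeaf (f v') := (hT.isLeaf_iff _).2 ⟨v', rfl⟩
  obtain ⟨p, hp⟩ := T.isTree.connected.exists_firstStep (v := f v') (y := f ⟨u, hux⟩)
    (fun h => huv (congrArg Subtype.val (hT.injective h)).symm)
  let g : V → T.Vert ⊕ Bool := fun y =>
    if hy : y = x then .inr true else if y = v then .inr false else .inl (f ⟨y, hy⟩)
  have gx : g x = .inr true := dif_pos rfl
  have gv : g v = .inr false := by simp [g, hxv.symm]
  have gy : ∀ {y} (hy : y ≠ x), y ≠ v → g y = .inl (f ⟨y, hy⟩) := by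
    intro y hy hyv
    simp [g, hy, hyv]
  have fne : ∀ {y} (hy : y ≠ x), y ≠ v → f ⟨y, hy⟩ ≠ f v' := fun hy hyv h =>
    hyv (congrArg Subtype.val (hT.injective h))
  -- accessibility between the new leaves and the old ones
  have acc_v : ∀ y, y ≠ x → y ≠ v →
      (G.Adj v y ↔ (T.extend (f v') tw (G.Adj x v)).IsAccessible (g v) (g y)) := by
    intro y hy hyv
    rw [gv, gy hy hyv, extend_isAccessible_inr_inl hleaf (fne hy hyv), ← hT.adj_iff]
    simp [v']
  have acc_x : ∀ y, y ≠ x → y ≠ v →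
      (G.Adj x y ↔ (T.extend (f v') tw (G.Adj x v)).IsAccessible (g x) (g y)) := by
    intro y hy hyv
    rw [gx, gy hy hyv, extend_isAccessible_inr_inl hleaf (fne hy hyv), ← hT.adj_iff,
      hx y hy hyv]
    simp [v']
  have acc_xv : G.Adj x v ↔ (T.extend (f v') tw (G.Adj x v)).IsAccessible (g x) (g v) := by
    rw [gx, gv, extend_isAccessible_inr_inr (by simp)]
  have acc_comm : ∀ {a b},
      (G.Adj a b ↔ (T.extend (f v') tw (G.Adj x v)).IsAccessible (g a) (g b)) →
      (G.Adj b a ↔ (T.extend (f v') tw (G.Adj x v)).IsAccessible (g b) (g a)) := by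
    intro a b h
    rw [G.adj_comm, h]
    exact ⟨fun h => h.symm, fun h => h.symm⟩
  refine ⟨T.extend (f v') tw (G.Adj x v), g, hT.isCliqueStar.extend hleaf hp.1 htw, ?_, ?_, ?_⟩
  · intro a b hab
    simp only [g] at hab
    split_ifs at hab
    all_goals first
      | exact congrArg Subtype.val (hT.injective (Sum.inl_injective hab))
      | exact ‹a = x›.trans ‹b = x›.symm
      | exact ‹a = v›.trans ‹b = v›.symm
      | simp at hab
  · rintro (t | k)
    · rw [extend_isLeaf_inl, hT.isLeaf_iff]
      constructor
      · rintro ⟨hne, ⟨y, hy⟩, rfl⟩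
        exact ⟨y, gy hy (by rintro rfl; exact hne rfl)⟩
      · rintro ⟨y, h⟩
        by_cases hy : y = x
        · rw [hy, gx] at h
          exact absurd h Sum.inr_ne_inl
        by_cases hyv : y = v
        · rw [hyv, gv] at h
          exact absurd h Sum.inr_ne_inl
        rw [gy hy hyv] at h
        obtain rfl := Sum.inl_injective h
        exact ⟨fne hy hyv, _, rfl⟩
    · refine iff_of_true (extend_isLeaf_inr k) ?_
      cases k
      exacts [⟨v, gv⟩, ⟨x, gx⟩]
  · intro a b
    by_cases hab : a = b
    · subst hab
      exact iff_of_false G.irrefl fun h => h.1 rfl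
    by_cases hax : a = x
    · subst hax
      by_cases hbv : b = v
      · subst hbv
        exact acc_xv
      · exact acc_x b (Ne.symm hab) hbv
    by_cases hbx : b = x
    · subst hbx
      by_cases hav : a = v
      · subst hav
        exact acc_comm acc_xv
      · exact acc_comm (acc_x a hab hav)
    by_cases hav : a = v
    · subst hav
      exact acc_v b hbx (Ne.symm hab)
    by_cases hbv : b = v
    · subst hbv
      exact acc_comm (acc_v a hax hab)
    rw [gy hax hav, gy hbx hbv, extend_isAccessible_inl_inl, ← hT.adj_iff]
    rfl

theorem WalksMeetCommonNeighbors.exists_represents {V : Type u} [Finite V] {G : SimpleGraph V}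
    (hG : G.WalksMeetCommonNeighbors) (hc : G.Connected) :
    ∃ (T : GraphLabelledTree.{u}) (f : V → T.Vert), T.Represents f G := by
  induction hn : Nat.card V using Nat.strong_induction_on generalizing V with
  | _ n ih =>
    by_cases hV : Nat.card V ≤ 2
    · exact hc.exists_represents_of_card_le_two hV
    obtain ⟨x, v, tw, hxv, htw, hx⟩ := hG.exists_pendant_or_twin hc (by omega)
    obtain ⟨u, hu⟩ : ∃ u, u ∉ ({x, v} : Set V) := by
      by_contra! h
      have := Set.ncard_pair hxv
      rw [Set.eq_univ_of_forall h, Set.ncard_univ] at this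
      omega
    simp only [Set.mem_insert_iff, Set.mem_singleton_iff, not_or] at hu
    have hcard : Nat.card ({x}ᶜ : Set V) < n := by
      have := Set.ncard_add_ncard_compl {x}
      rw [Set.ncard_singleton] at this
      rw [Nat.card_coe_set_eq]
      omega
    obtain ⟨T, f, hT⟩ := ih _ hcard (hG.induce {x}ᶜ)
      (hc.induce_compl_singleton hxv fun z hzv hxz => ((hx z hxz.ne' hzv).1 hxz).2) rfl
    exact exists_represents_of_induce hxv hu.1 hu.2 htw hx hT

/-- The trees of the connected components represent the whole graph. -/
theorem WalksMeetCommonNeighbors.exists_equiv_leaves {V : Type u} [Finite V] {G : SimpleGraph V}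
    (hG : G.WalksMeetCommonNeighbors) :
    ∃ (ι : Type u) (𝒯 : ι → GraphLabelledTree.{u}), (∀ i, (𝒯 i).IsCliqueStar) ∧
      ∃ leafOf : V ≃ Leaves 𝒯,
        G = intersectionGraph (fun v => accessibilitySet 𝒯 (leafOf v)) := by
  have h : ∀ c : G.ConnectedComponent, ∃ (T : GraphLabelledTree.{u}) (f : c.supp → T.Vert),
      T.Represents f (G.induce c.supp) := fun c =>
    (hG.induce c.supp).exists_represents c.connected_toSimpleGraph
  choose 𝒯 f hf using h
  let leafOf : V → Leaves 𝒯 := fun v =>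
    ⟨⟨G.connectedComponentMk v, f _ ⟨v, rfl⟩⟩, ((hf _).isLeaf_iff _).2 ⟨_, rfl⟩⟩
  have leafOf_eq : ∀ {v c} (hv : v ∈ c.supp), (leafOf v).1 = ⟨c, f c ⟨v, hv⟩⟩ := by
    rintro v c rfl
    rfl
  have bij : Function.Bijective leafOf := by
    constructor
    · intro v w hvw
      have hvw : (leafOf v).1 = (leafOf w).1 := congrArg Subtype.val hvw
      have hc : G.connectedComponentMk v = G.connectedComponentMk w := congrArg Sigma.fst hvw
      rw [leafOf_eq (c := G.connectedComponentMk w) hc, leafOf_eq (v := w) rfl] at hvw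
      exact congrArg Subtype.val ((hf _).injective (eq_of_heq (Sigma.mk.inj hvw).2))
    · rintro ⟨⟨c, t⟩, ht⟩
      obtain ⟨⟨v, hv⟩, rfl⟩ := ((hf c).isLeaf_iff t).1 ht
      exact ⟨v, Subtype.ext (leafOf_eq hv)⟩
  refine ⟨G.ConnectedComponent, 𝒯, fun c => (hf c).isCliqueStar, Equiv.ofBijective leafOf bij, ?_⟩
  ext x y
  change G.Adj x y ↔
    x ≠ y ∧ (accessibilitySet 𝒯 (leafOf x) ∩ accessibilitySet 𝒯 (leafOf y)).Nonempty
  by_cases hxy : x = y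
  · exact iff_of_false (fun h => h.ne hxy) fun h => h.1 hxy
  rw [and_iff_right hxy, nonempty_inter_accessibilitySet (bij.1.ne hxy)]
  constructor
  · intro h
    have hc : y ∈ (G.connectedComponentMk x).supp :=
      (ConnectedComponent.connectedComponentMk_eq_of_adj h).symm
    exact ⟨_, _, _, leafOf_eq rfl, leafOf_eq hc, ((hf _).adj_iff ⟨x, rfl⟩ ⟨y, hc⟩).1 h⟩
  · rintro ⟨c, a, b, ha, hb, hab⟩
    have hx : x ∈ c.supp := congrArg Sigma.fst ha
    have hy : y ∈ c.supp := congrArg Sigma.fst hb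
    rw [leafOf_eq hx] at ha
    rw [leafOf_eq hy] at hb
    obtain rfl := eq_of_heq (Sigma.mk.inj ha).2
    obtain rfl := eq_of_heq (Sigma.mk.inj hb).2
    exact ((hf c).adj_iff ⟨x, hx⟩ ⟨y, hy⟩).2 hab

end SimpleGraph

theorem mainTheorem3 {V : Type u} [Finite V] (G : SimpleGraph V) :
    (G.IsDistanceHereditary ↔
      ∃ (ι : Type u) (𝒯 : ι → GraphLabelledTree.{u}),
        (∀ i, (𝒯 i).IsCliqueStar) ∧
        ∃ leafOf : V → GraphLabelledTree.Leaves 𝒯,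
          G = intersectionGraph (fun v => GraphLabelledTree.accessibilitySet 𝒯 (leafOf v))) ∧
    (G.IsDistanceHereditary →
      ∃ (ι : Type u) (𝒯 : ι → GraphLabelledTree.{u}),
        (∀ i, (𝒯 i).IsCliqueStar) ∧
        ∃ leafOf : V ≃ GraphLabelledTree.Leaves 𝒯,
          G = intersectionGraph (fun v => GraphLabelledTree.accessibilitySet 𝒯 (leafOf v))) := by
  rw [SimpleGraph.isDistanceHereditary_iff]
  refine ⟨⟨fun hG => ?_, ?_⟩, fun hG => hG.exists_equiv_leaves⟩
  · obtain ⟨ι, 𝒯, h𝒯, leafOf, h⟩ := hG.exists_equiv_leaves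
    exact ⟨ι, 𝒯, h𝒯, leafOf, h⟩
  · rintro ⟨ι, 𝒯, h𝒯, leafOf, h⟩
    rw [h]
    exact GraphLabelledTree.walksMeetCommonNeighbors_intersectionGraph h𝒯 leafOf
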